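/- For integers $u,v\ge 2$ and $n\ge 0$, let $B_{u,v}(n)$ be the number of $(u,v)$-regular bipartitions of $n$, i.e. of pairs $(\alpha,\beta)$ of partitions whose parts have total sum $n$, such that no part of $\alpha$ is divisible by $u$ and no part of $\beta$ is divisible by $v$ (so $B_{u,v}(0)=1$). **Theorem 1.2.** Let $k,n\ge 0$ be integers, let $p_1,\dots,p_{k+1}$ be (not necessarily distinct) primes, and let $j$ be an integer with $p_{k+1}\nmid j$. For $m\in\{3,4,8\}$ put $$A_m = p_1^2p_2^2\cdots p_k^2\,p_{k+1}^2\, n+\frac{p_1^2p_2^2\cdots p_k^2\,p_{k+1}\,(mj+p_{k+1})-1}{m}.$$ (i) Suppose $p_i\not\equiv 1\pmod 3$ for $1\le i\le k+1$. If no $p_i$ equals $3$, then $A_3$ is an integer; and whenever $A_3$ is a non-negative integer, $B_{3,7}(A_3)\equiv 0\pmod 3$. (ii) Suppose $p_i\equiv 3\pmod 4$ for $1\le i\le k+1$. Then $A_4$ is an integer; and whenever it is non-negative, $B_{3,5}(A_4)\equiv 0\pmod 3$. (iii) Suppose $p_i\not\equiv 1\pmod 8$ for $1\le i\le k+1$.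 If no $p_i$ equals $2$, then $A_8$ is an integer; and whenever $A_8$ is a non-negative integer, $B_{3,2}(A_8)\equiv 0\pmod 3$. -/

import Mathlib

/-- The `t`-regular partitions of `n`: those with no part divisible by `t`. -/
def regularPartitions (t n : ℕ) : Finset n.Partition :=
  Nat.Partition.restricted n (fun i => ¬ t ∣ i)

/-- The `(u, v)`-regular bipartitions of `n`: pairs `(α, β)` of a `u`-regular partition `α` of `a`
and a `v`-regular partition `β` of `b`, where `a + b = n`. -/
def regularBipartitions (u v n : ℕ) :
    Finset (Σ ab : ℕ × ℕ, ab.1.Partition × ab.2.Partition) :=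
  (Finset.HasAntidiagonal.antidiagonal n).sigma
    (fun ab => regularPartitions u ab.1 ×ˢ regularPartitions v ab.2)

/-- `B u v n` is the number of `(u, v)`-regular bipartitions of `n`. -/
def B (u v n : ℕ) : ℕ := (regularBipartitions u v n).card

/-- The rational number
`p₁² ⋯ pₖ² pₖ₊₁² n + (p₁² ⋯ pₖ² pₖ₊₁ (m j + pₖ₊₁) - 1) / m`,
where `pᵢ` is written `p (i - 1)` and `pₖ₊₁` is `p (Fin.last k)`. -/
def progressionArg (m : ℕ) {k : ℕ} (p : Fin (k + 1) → ℕ) (n : ℕ) (j : ℤ) : ℚ :=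
  (∏ i : Fin (k + 1), (p i : ℚ) ^ 2) * n +
    ((∏ i : Fin k, (p i.castSucc : ℚ) ^ 2) * (p (Fin.last k) : ℚ) *
      ((m : ℚ) * j + (p (Fin.last k) : ℚ)) - 1) / m

/-!
Let `E = ∏ (1 - X ^ i)`. The generating function of `B 3 v` is `E(X ^ 3) E(X ^ v) / E(X) ^ 2`, which
is `E(X) E(X ^ v)` modulo `3` (`mk_B_three`). By Euler's pentagonal number theorem its `n`-th
coefficient is the sum of `(-1) ^ (k + l)` over the solutions of `g k + v * g l = n`, where `g k` is
`k * (3 * k - 1) / 2` (`cast_B_three`). With `x = 6 * k - 1` and `y = 6 * l - 1` the equation reads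
`x ^ 2 + v * y ^ 2 = 24 * n + 1 + v`, and dividing `x + y √-v` by a fixed element turns the sum into
half of a weighted count `T(N)` of the integers of norm `N = m * n + 1` in `ℚ(√-v)`, with
`m = 24 / (1 + v)` (`thetaCoeff_seven_eq`, `thetaCoeff_five_eq`, `thetaCoeff_two_eq`).

`E(X) E(X ^ v)` is an eta quotient of weight one with complex multiplication, and `T` satisfies the
Hecke relation `T(p * M) = ± T(M / p)` at the primes `p` in question. If `p` stays prime in
`ℚ(√-v)`, this is because every integer of norm `p * M` is divisible by `p`. If `p` splits, it is
because the integers of norm `p * M` divisible by one prime `π` above `p` cancel in pairs: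
replacing `y * π` by `conj y * π` reverses the sign of the weight (`sum_filter_dvd_eq_zero`,
`thetaCoeff_eq_neg_sum_filter_dvd`). The element `π` comes from Thue's lemma
(`exists_normForm_eq_mul`); for `v = 5` the ideal need not be principal, and `π` has norm `2 * p`.
The cancellation is also what removes the integers of norm `N` that do not come from a pair `(k, l)`
(`sum_filter_dvd_add_eq_zero`).

Finally `m * A + 1 = p₁² ⋯ pₖ² * p * L` with `p = pₖ₊₁` and `p ∤ L`, so the Hecke relations reduce
`T(m * A + 1)` to `± T(p * L) = 0` (`thetaCoeff_prod_sq_mul_eq_zero`).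
-/

/-! ### Generating functions -/

open PowerSeries PowerSeries.WithPiTopology in
/-- The Euler product of `expand m E`, where `E = ∏ (1 - X ^ (i + 1))`. -/
theorem hasProd_expand_pentagonalSeries (R : Type*) [CommRing R] [TopologicalSpace R]
    (m : ℕ) (hm : m ≠ 0) :
    HasProd (fun i ↦ (1 - (X ^ (i + 1)) ^ m : PowerSeries R))
      (expand m hm (pentagonalSeries R)) := by
  have hcont : Continuous (expand m hm : PowerSeries R →ₐ[R] PowerSeries R) := by
    refine continuous_iff_continuousAt.2 fun f ↦ (tendsto_iff_coeff_tendsto R _ _ _).2 fun d ↦ ?_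
    simp only [coeff_expand]
    split_ifs
    · exact (continuous_coeff R _).tendsto f
    · exact tendsto_const_nhds
  convert! (hasProd_one_sub_X_pow R).map
    (expand m hm : PowerSeries R →ₐ[R] PowerSeries R) hcont using 2 with i
  simp [← pow_mul, mul_comm]

open PowerSeries PowerSeries.WithPiTopology Finset in
/-- Cross-multiplied form of `∑ b_m(n) X ^ n = E(X ^ m) / E(X)`. It is stated modulo `3`, since that
is the only case needed. -/
theorem mk_card_regularPartitions_mul_pentagonalSeries (m : ℕ) (hm : m ≠ 0) :
    PowerSeries.mk (fun n ↦ ((regularPartitions m n).card : ZMod 3)) * pentagonalSeries (ZMod 3) =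
      expand m hm (pentagonalSeries (ZMod 3)) := by
  have : Fact (Nat.Prime 3) := ⟨Nat.prime_three⟩
  let _ : TopologicalSpace (ZMod 3) := ⊥
  have _ : DiscreteTopology (ZMod 3) := ⟨rfl⟩
  have h1 := (Nat.Partition.hasProd_powerSeriesMk_card_countRestricted (ZMod 3)
    (Nat.pos_of_ne_zero hm)).mul (hasProd_one_sub_X_pow (ZMod 3))
  rw [← Nat.Partition.powerSeriesMk_card_restricted_eq_powerSeriesMk_card_countRestricted (ZMod 3)
    (Nat.pos_of_ne_zero hm)] at h1
  refine HasProd.unique ?_ (hasProd_expand_pentagonalSeries (ZMod 3) m hm)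
  convert! h1 using 2 with i
  simp_rw [pow_mul, geom_sum_mul_neg]

open PowerSeries PowerSeries.WithPiTopology in
theorem expand_three_pentagonalSeries :
    expand 3 three_ne_zero (pentagonalSeries (ZMod 3)) = pentagonalSeries (ZMod 3) ^ 3 := by
  let _ : TopologicalSpace (ZMod 3) := ⊥
  have _ : DiscreteTopology (ZMod 3) := ⟨rfl⟩
  have h3 : (3 : PowerSeries (ZMod 3)) = 0 := by
    rw [← map_ofNat (C (R := ZMod 3)) 3, show (OfNat.ofNat 3 : ZMod 3) = 0 from rfl, map_zero]
  have h := hasProd_one_sub_X_pow (ZMod 3)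
  refine HasProd.unique (hasProd_expand_pentagonalSeries (ZMod 3) 3 three_ne_zero) ?_
  convert! (h.mul h).mul h using 2 with i
  · linear_combination (X ^ (i + 1) - (X ^ (i + 1)) ^ 2) * h3
  · ring

open PowerSeries in
theorem mk_card_three_regularPartitions :
    PowerSeries.mk (fun n ↦ ((regularPartitions 3 n).card : ZMod 3)) =
      pentagonalSeries (ZMod 3) ^ 2 := by
  have : Fact (Nat.Prime 3) := ⟨Nat.prime_three⟩
  have h0 : pentagonalSeries (ZMod 3) ≠ 0 := by
    intro h
    have := coeff_pentagonalSeries_pentagonal (ZMod 3) 0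
    rw [h] at this
    simp at this
  apply mul_right_cancel₀ h0
  rw [mk_card_regularPartitions_mul_pentagonalSeries 3 three_ne_zero, expand_three_pentagonalSeries]
  ring

open PowerSeries in
/-- Modulo `3`, the generating function `E(X ^ 3) E(X ^ v) / E(X) ^ 2` of the `(3, v)`-regular
bipartitions is the product `E(X) * E(X ^ v)`, by the Frobenius congruence. -/
theorem mk_B_three (v : ℕ) (hv : v ≠ 0) :
    PowerSeries.mk (fun n ↦ (B 3 v n : ZMod 3)) =
      pentagonalSeries (ZMod 3) * expand v hv (pentagonalSeries (ZMod 3)) := by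
  rw [← mk_card_regularPartitions_mul_pentagonalSeries v hv, mul_left_comm, ← sq,
    ← mk_card_three_regularPartitions, mul_comm]
  ext n
  simp [coeff_mul, B, regularBipartitions]

/-- The pairs `(k, l)` of integers whose generalized pentagonal numbers `g` satisfy
`g k + v * g l = n`; the box is large enough to contain all of them when `v ≠ 0`. -/
noncomputable def pentagonalPairs (v n : ℕ) : Finset (ℤ × ℤ) :=
  (Finset.Icc (-(2 * n : ℤ)) (2 * n) ×ˢ Finset.Icc (-(2 * n : ℤ)) (2 * n)).filter
    fun x ↦ x.1 * (3 * x.1 - 1) + v * (x.2 * (3 * x.2 - 1)) = 2 * n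

theorem abs_le_mul_three_mul_sub_one (k : ℤ) : |k| ≤ k * (3 * k - 1) := by
  rcases abs_cases k with ⟨h, h'⟩ | ⟨h, h'⟩ <;> rw [h]
  · rcases h'.eq_or_lt with h | h
    · simp [← h]
    · nlinarith
  · nlinarith

theorem mem_pentagonalPairs {v n : ℕ} (hv : v ≠ 0) {x : ℤ × ℤ} :
    x ∈ pentagonalPairs v n ↔ x.1 * (3 * x.1 - 1) + v * (x.2 * (3 * x.2 - 1)) = 2 * n := by
  simp only [pentagonalPairs, Finset.mem_filter, Finset.mem_product, Finset.mem_Icc,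
    and_iff_right_iff_imp, ← abs_le]
  intro h
  have h1 := abs_le_mul_three_mul_sub_one x.1
  have h2 := abs_le_mul_three_mul_sub_one x.2
  have h3 := abs_nonneg x.1
  have h4 := abs_nonneg x.2
  have h5 : (1 : ℤ) ≤ v := by exact_mod_cast Nat.one_le_iff_ne_zero.2 hv
  constructor <;> nlinarith

open PowerSeries in
/-- Euler's pentagonal number theorem applied to both factors of `E(X) * E(X ^ v)`. -/
theorem cast_B_three (v n : ℕ) (hv : v ≠ 0) :
    (B 3 v n : ZMod 3) =
      ((∑ x ∈ pentagonalPairs v n, ((x.1 + x.2).negOnePow : ℤ) : ℤ) : ZMod 3) := by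
  have h := congrArg (coeff n) (mk_B_three v hv)
  rw [coeff_mk, coeff_mul] at h
  rw [h, Int.cast_sum]
  symm
  refine Finset.sum_of_injOn (fun x ↦ (pentagonal x.1, v * pentagonal x.2)) ?_ ?_ ?_ ?_
  · rintro ⟨a, b⟩ - ⟨c, d⟩ - h
    simpa [hv] using h
  · intro x hx
    have := (mem_pentagonalPairs hv).1 hx
    rw [← two_mul_natCast_pentagonal, ← two_mul_natCast_pentagonal] at this
    simp only [Finset.mem_coe, Finset.HasAntidiagonal.mem_antidiagonal]
    zify
    linarith
  · rintro ⟨i, j⟩ hij hx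
    rw [Finset.HasAntidiagonal.mem_antidiagonal] at hij
    simp only at hij ⊢
    by_contra hne
    obtain ⟨h1, h2⟩ := ne_zero_and_ne_zero_of_mul hne
    have h1' : i ∈ Set.range pentagonal := by
      by_contra h
      exact h1 (coeff_pentagonalSeries_eq_zero _ h)
    obtain ⟨k, rfl⟩ := h1'
    rw [coeff_expand] at h2
    split_ifs at h2 with hd
    · obtain ⟨j, rfl⟩ := hd
      rw [Nat.mul_div_cancel_left _ (Nat.pos_of_ne_zero hv)] at h2
      have h2' : j ∈ Set.range pentagonal := by
        by_contra h
        exact h2 (coeff_pentagonalSeries_eq_zero _ h)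
      obtain ⟨l, rfl⟩ := h2'
      refine hx ⟨(k, l), ?_, rfl⟩
      rw [Finset.mem_coe, mem_pentagonalPairs hv, ← two_mul_natCast_pentagonal,
        ← two_mul_natCast_pentagonal]
      zify at hij
      linarith
    · exact h2 rfl
  · intro x _
    simp [Int.negOnePow_add, coeff_expand_mul]

/-! ### Norm forms and their theta coefficients -/

/-- The norm `a ^ 2 + s * a * b + c * b ^ 2` of `a + b * ω`, where `ω ^ 2 = s * ω - c`; the element
`a + b * ω` is encoded as the pair `(a, b)`. -/
def normForm (s c : ℤ) (x : ℤ × ℤ) : ℤ := x.1 ^ 2 + s * x.1 * x.2 + c * x.2 ^ 2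

/-- The conjugate of `a + b * ω`. -/
def conjPair (s : ℤ) (x : ℤ × ℤ) : ℤ × ℤ := (x.1 + s * x.2, -x.2)

/-- The product of `a + b * ω` and `u + v * ω`. -/
def mulPair (s c : ℤ) (x y : ℤ × ℤ) : ℤ × ℤ :=
  (x.1 * y.1 - c * x.2 * y.2, x.1 * y.2 + x.2 * y.1 + s * x.2 * y.2)

/-- The elements of norm `N`; the box contains all of them when `normForm s c` is positive
definite. -/
noncomputable def normReps (s c N : ℤ) : Finset (ℤ × ℤ) :=
  (Finset.Icc (-(4 * (c + 1) * N)) (4 * (c + 1) * N) ×ˢ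
    Finset.Icc (-(4 * (c + 1) * N)) (4 * (c + 1) * N)).filter fun x ↦ normForm s c x = N

/-- The `N`-th coefficient of the theta series of `normForm s c` with weight `φ`. -/
noncomputable def thetaCoeff (s c : ℤ) (φ : ℤ × ℤ → ℤ) (N : ℤ) : ℤ := ∑ x ∈ normReps s c N, φ x

variable {s c : ℤ}

theorem four_mul_normForm (s c : ℤ) (x : ℤ × ℤ) :
    4 * normForm s c x = (2 * x.1 + s * x.2) ^ 2 + (4 * c - s ^ 2) * x.2 ^ 2 := by
  unfold normForm; ring

theorem four_mul_mul_normForm (s c : ℤ) (x : ℤ × ℤ) :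
    4 * c * normForm s c x = (2 * c * x.2 + s * x.1) ^ 2 + (4 * c - s ^ 2) * x.1 ^ 2 := by
  unfold normForm; ring

theorem normForm_conjPair (s c : ℤ) (x : ℤ × ℤ) :
    normForm s c (conjPair s x) = normForm s c x := by
  unfold normForm conjPair; ring

theorem normForm_mulPair (s c : ℤ) (x y : ℤ × ℤ) :
    normForm s c (mulPair s c x y) = normForm s c x * normForm s c y := by
  unfold normForm mulPair; ring

theorem conjPair_conjPair (s : ℤ) (x : ℤ × ℤ) : conjPair s (conjPair s x) = x := by
  ext <;> simp [conjPair]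

theorem mem_normReps (hD : 0 < 4 * c - s ^ 2) {N : ℤ} {x : ℤ × ℤ} :
    x ∈ normReps s c N ↔ normForm s c x = N := by
  simp only [normReps, Finset.mem_filter, Finset.mem_product, Finset.mem_Icc,
    and_iff_right_iff_imp, ← abs_le]
  rintro rfl
  have hc : 0 < c := by nlinarith [sq_nonneg s]
  have h1 := four_mul_normForm s c x
  have h2 := four_mul_mul_normForm s c x
  have h3 : ∀ z : ℤ, |z| ≤ z ^ 2 := fun z ↦ by
    rw [← sq_abs]
    rcases (abs_nonneg z).eq_or_lt with h | h
    · simp [← h]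
    · nlinarith
  have h4 : ∀ z : ℤ, z ^ 2 ≤ (4 * c - s ^ 2) * z ^ 2 := fun z ↦ by nlinarith [sq_nonneg z]
  have h5 : 0 ≤ normForm s c x := by nlinarith [sq_nonneg (2 * x.1 + s * x.2), sq_nonneg x.2]
  have h6 : 0 ≤ c * normForm s c x := by positivity
  constructor
  · nlinarith [h3 x.1, h4 x.1, sq_nonneg (2 * c * x.2 + s * x.1)]
  · nlinarith [h3 x.2, h4 x.2, sq_nonneg (2 * x.1 + s * x.2)]

theorem normForm_pos (hD : 0 < 4 * c - s ^ 2) {x : ℤ × ℤ} (hx : x ≠ 0) : 0 < normForm s c x := by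
  have h1 := four_mul_normForm s c x
  by_contra! h
  have h2 : x.2 = 0 := by
    by_contra h2
    have : 0 < x.2 ^ 2 := by positivity
    nlinarith [sq_nonneg (2 * x.1 + s * x.2)]
  rw [h2] at h1
  have h3 : x.1 = 0 := by
    by_contra h3
    have : 0 < x.1 ^ 2 := by positivity
    nlinarith
  exact hx (Prod.ext h3 h2)

/-- Let `π = u + v * ω` have norm `e * p`, and let `𝔭` be the prime above `p` that contains `π`. The
elements of norm `p * M` in `𝔭` contribute zero to the theta coefficient: they are the elements
`y * π / e` with `y` of norm `e * M`, and the terms of `y` and of its conjugate cancel. The case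
`e = 1` is that of a principal `𝔭`. -/
theorem sum_filter_dvd_eq_zero (hD : 0 < 4 * c - s ^ 2) (φ : ℤ × ℤ → ℤ) {p : ℕ} (hp : p.Prime)
    {e M : ℤ} (he : e ≠ 0) {u v : ℤ} (hπ : normForm s c (u, v) = e * p) (hv : ¬ (p : ℤ) ∣ v)
    (hφ : ∀ y, normForm s c y = e * M → ∃ z z' : ℤ × ℤ, mulPair s c y (u, v) = e • z ∧
      mulPair s c (conjPair s y) (u, v) = e • z' ∧ φ z + φ z' = 0) :
    ∑ x ∈ (normReps s c (p * M)).filter (fun x ↦ (p : ℤ) ∣ x.2 * u - x.1 * v), φ x = 0 := by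
  have hpp : Prime (p : ℤ) := Nat.prime_iff_prime_int.1 hp
  have hp0 : (p : ℤ) ≠ 0 := hpp.ne_zero
  have hsmul : ∀ z : ℤ × ℤ, normForm s c (e • z) = e ^ 2 * normForm s c z := fun z ↦ by
    simp only [normForm, Prod.smul_fst, Prod.smul_snd, smul_eq_mul]; ring
  have hinj : ∀ {z w : ℤ × ℤ}, e • z = e • w → z = w := fun h ↦ by
    simpa [Prod.ext_iff, he] using h
  choose! F F' hF hF' hFF' using hφ
  have hFconj : ∀ y, normForm s c y = e * M → F (conjPair s y) = F' y := fun y hy ↦ by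
    apply hinj
    rw [← hF _ (by rw [normForm_conjPair, hy]), hF' y hy]
  have hsum : ∑ x ∈ (normReps s c (p * M)).filter (fun x ↦ (p : ℤ) ∣ x.2 * u - x.1 * v), φ x =
      ∑ y ∈ normReps s c (e * M), φ (F y) := by
    symm
    refine Finset.sum_nbij F ?_ ?_ ?_ (fun _ _ ↦ rfl)
    · intro y hy
      rw [mem_normReps hD] at hy
      rw [Finset.mem_filter, mem_normReps hD]
      have h1 := hF y hy
      constructor
      · have := normForm_mulPair s c y (u, v)
        rw [h1, hsmul, hy, hπ] at this
        have he2 : e ^ 2 ≠ 0 := pow_ne_zero 2 he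
        apply mul_left_cancel₀ he2
        linear_combination this
      · refine ⟨y.2, mul_left_cancel₀ he ?_⟩
        simp only [mulPair, Prod.ext_iff, Prod.smul_fst, Prod.smul_snd, smul_eq_mul] at h1
        simp only [normForm] at hπ
        linear_combination v * h1.1 - u * h1.2 + y.2 * hπ
    · intro y hy z hz hyz
      rw [Finset.mem_coe, mem_normReps hD] at hy hz
      have h1 := hF y hy
      have h2 := hF z hz
      rw [hyz, ← h2] at h1
      simp only [mulPair, Prod.ext_iff] at h1
      simp only [normForm] at hπ
      have h0 : e * (p : ℤ) ≠ 0 := mul_ne_zero he hp0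
      ext
      · apply mul_left_cancel₀ h0
        linear_combination (u + s * v) * h1.1 + c * v * h1.2 - (y.1 - z.1) * hπ
      · apply mul_left_cancel₀ h0
        linear_combination - v * h1.1 + u * h1.2 - (y.2 - z.2) * hπ
    · rintro ⟨a, b⟩ hx
      rw [Finset.mem_coe, Finset.mem_filter, mem_normReps hD] at hx
      obtain ⟨hN, t, ht⟩ := hx
      simp only at ht
      obtain ⟨r, hr⟩ : (p : ℤ) ∣ a * (u + s * v) + c * b * v := by
        refine (hpp.dvd_or_dvd (a := v) ?_).resolve_left hv
        refine ⟨b * e - (u + s * v) * t, ?_⟩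
        simp only [normForm] at hπ
        linear_combination b * hπ - (u + s * v) * ht
      have hrt : normForm s c (r, t) = e * M := by
        have h2 : (p : ℤ) ^ 2 ≠ 0 := pow_ne_zero 2 hp0
        apply mul_left_cancel₀ h2
        have : (p : ℤ) ^ 2 * normForm s c (r, t) = normForm s c (a, b) * normForm s c (u, v) := by
          have : (p : ℤ) ^ 2 * normForm s c (r, t) = normForm s c (p * r, p * t) := by
            simp only [normForm]; ring
          rw [this, ← hr, ← ht]
          simp only [normForm]; ring
        rw [this, hN, hπ]
        ring
      refine ⟨(r, t), by rw [Finset.mem_coe, mem_normReps hD, hrt], hinj ?_⟩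
      rw [← hF _ hrt]
      simp only [normForm] at hπ
      simp only [mulPair, Prod.ext_iff, Prod.smul_fst, Prod.smul_snd, smul_eq_mul]
      constructor
      · apply mul_left_cancel₀ hp0
        linear_combination -u * hr + c * v * ht + a * hπ
      · apply mul_left_cancel₀ hp0
        linear_combination -v * hr - (u + s * v) * ht + b * hπ
  have hsum' : ∑ y ∈ normReps s c (e * M), φ (F y) = ∑ y ∈ normReps s c (e * M), φ (F' y) := by
    refine Finset.sum_nbij' (conjPair s) (conjPair s) ?_ ?_ ?_ ?_ ?_
    · intro y hy
      rwa [mem_normReps hD, normForm_conjPair, ← mem_normReps hD]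
    · intro y hy
      rwa [mem_normReps hD, normForm_conjPair, ← mem_normReps hD]
    · intro y _
      exact conjPair_conjPair s y
    · intro y _
      exact conjPair_conjPair s y
    · intro y hy
      rw [mem_normReps hD] at hy
      rw [← hFconj _ (by rw [normForm_conjPair, hy]), conjPair_conjPair]
  have h0 : ∑ y ∈ normReps s c (e * M), φ (F y) + ∑ y ∈ normReps s c (e * M), φ (F' y) = 0 := by
    rw [← Finset.sum_add_distrib]
    exact Finset.sum_eq_zero fun y hy ↦ hFF' y ((mem_normReps hD).1 hy)
  rw [hsum]
  omega

/-- The Hecke relation at a prime `p` that splits: if the elements of one prime above `p` contribute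
zero to the theta coefficient at `p * M`, then so do those of the conjugate prime. Every element of
norm `p * M` lies in one of the two primes, and those in both are the multiples of `p`. -/
theorem thetaCoeff_eq_neg_sum_filter_dvd (hD : 0 < 4 * c - s ^ 2) {φ : ℤ × ℤ → ℤ} {p : ℕ}
    (hp : p.Prime) {e M : ℤ} {u v : ℤ} (hπ : normForm s c (u, v) = e * p)
    (hv : ¬ (p : ℤ) ∣ v) (huv : ¬ (p : ℤ) ∣ 2 * u + s * v)
    (hφ : ∀ x, normForm s c x = p * M → φ (conjPair s x) = φ x)
    (h0 : ∑ x ∈ (normReps s c (p * M)).filter (fun x ↦ (p : ℤ) ∣ x.2 * u - x.1 * v), φ x = 0) :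
    thetaCoeff s c φ (p * M) =
      -∑ x ∈ (normReps s c (p * M)).filter (fun x ↦ (p : ℤ) ∣ x.1 ∧ (p : ℤ) ∣ x.2), φ x := by
  have hpp : Prime (p : ℤ) := Nat.prime_iff_prime_int.1 hp
  have h1 : ∑ x ∈ (normReps s c (p * M)).filter
      (fun x ↦ (p : ℤ) ∣ x.1 * v + x.2 * u + s * x.2 * v), φ x = 0 := by
    rw [← h0]
    have key : ∀ x : ℤ × ℤ, (p : ℤ) ∣ (conjPair s x).2 * u - (conjPair s x).1 * v ↔
        (p : ℤ) ∣ x.1 * v + x.2 * u + s * x.2 * v := fun x ↦ by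
      rw [← dvd_neg]
      simp only [conjPair]
      ring_nf
    refine Finset.sum_nbij' (conjPair s) (conjPair s) ?_ ?_ ?_ ?_ ?_
    · intro x hx
      rw [Finset.mem_filter, mem_normReps hD] at hx ⊢
      rwa [normForm_conjPair, key]
    · intro x hx
      rw [Finset.mem_filter, mem_normReps hD] at hx ⊢
      rwa [normForm_conjPair, ← key, conjPair_conjPair]
    · intro y _
      exact conjPair_conjPair s y
    · intro y _
      exact conjPair_conjPair s y
    · intro x hx
      rw [Finset.mem_filter, mem_normReps hD] at hx
      exact (hφ x hx.1).symm
  have h2 := Finset.sum_union_inter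
    (s₁ := (normReps s c (p * M)).filter (fun x ↦ (p : ℤ) ∣ x.2 * u - x.1 * v))
    (s₂ := (normReps s c (p * M)).filter
      (fun x ↦ (p : ℤ) ∣ x.1 * v + x.2 * u + s * x.2 * v)) (f := φ)
  rw [h0, h1, ← Finset.filter_or, ← Finset.filter_and] at h2
  have h3 : (normReps s c (p * M)).filter (fun x ↦ (p : ℤ) ∣ x.2 * u - x.1 * v ∨
      (p : ℤ) ∣ x.1 * v + x.2 * u + s * x.2 * v) = normReps s c (p * M) := by
    refine Finset.filter_true_of_mem fun x hx ↦ hpp.dvd_or_dvd ?_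
    rw [mem_normReps hD] at hx
    simp only [normForm] at hx hπ
    refine ⟨x.2 ^ 2 * e - v ^ 2 * M, ?_⟩
    linear_combination x.2 ^ 2 * hπ - v ^ 2 * hx
  have h4 : (normReps s c (p * M)).filter (fun x ↦ (p : ℤ) ∣ x.2 * u - x.1 * v ∧
      (p : ℤ) ∣ x.1 * v + x.2 * u + s * x.2 * v) =
      (normReps s c (p * M)).filter (fun x ↦ (p : ℤ) ∣ x.1 ∧ (p : ℤ) ∣ x.2) := by
    refine Finset.filter_congr fun x _ ↦ ⟨fun h ↦ ?_, fun h ↦ ⟨?_, ?_⟩⟩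
    · have hb : (p : ℤ) ∣ x.2 := by
        refine (hpp.dvd_or_dvd (b := 2 * u + s * v) ?_).resolve_right huv
        have := dvd_add h.1 h.2
        ring_nf at this ⊢
        exact this
      refine ⟨(hpp.dvd_or_dvd (b := v) ?_).resolve_right hv, hb⟩
      have := dvd_sub (hb.mul_right u) h.1
      simpa using this
    · exact dvd_sub (h.2.mul_right _) (h.1.mul_right _)
    · exact dvd_add (dvd_add (h.1.mul_right _) (h.2.mul_right _)) ((h.2.mul_left _).mul_right _)
  rw [h3, h4] at h2
  unfold thetaCoeff
  omega

/-- At a prime `p` that stays prime, all elements of norm divisible by `p` are divisible by `p`. -/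
theorem thetaCoeff_eq_sum_filter_dvd (hD : 0 < 4 * c - s ^ 2) {φ : ℤ × ℤ → ℤ} {p M : ℤ}
    (hinert : ∀ x, p ∣ normForm s c x → p ∣ x.1 ∧ p ∣ x.2) :
    thetaCoeff s c φ (p * M) =
      ∑ x ∈ (normReps s c (p * M)).filter (fun x ↦ p ∣ x.1 ∧ p ∣ x.2), φ x := by
  rw [thetaCoeff, Finset.filter_true_of_mem]
  intro x hx
  exact hinert x ⟨M, (mem_normReps hD).1 hx⟩

theorem sum_filter_dvd_eq_thetaCoeff (hD : 0 < 4 * c - s ^ 2) {φ : ℤ × ℤ → ℤ} {p : ℤ} (hp : p ≠ 0)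
    (hφ : ∀ x, φ (p • x) = φ x) (M : ℤ) :
    ∑ x ∈ (normReps s c (p * (p * M))).filter (fun x ↦ p ∣ x.1 ∧ p ∣ x.2), φ x =
      thetaCoeff s c φ M := by
  have hsmul : ∀ z : ℤ × ℤ, normForm s c (p • z) = p * (p * normForm s c z) := fun z ↦ by
    simp only [normForm, Prod.smul_fst, Prod.smul_snd, smul_eq_mul]; ring
  symm
  refine Finset.sum_nbij (p • ·) ?_ ?_ ?_ (fun x _ ↦ (hφ x).symm)
  · intro x hx
    rw [mem_normReps hD] at hx
    rw [Finset.mem_filter, mem_normReps hD, hsmul, hx]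
    exact ⟨rfl, by simp, by simp⟩
  · intro x _ y _ h
    simpa [Prod.ext_iff, hp] using h
  · rintro ⟨a, b⟩ hx
    rw [Finset.mem_coe, Finset.mem_filter, mem_normReps hD] at hx
    obtain ⟨hN, ⟨a, rfl⟩, ⟨b, rfl⟩⟩ := hx
    refine ⟨(a, b), ?_, rfl⟩
    rw [Finset.mem_coe, mem_normReps hD]
    apply mul_left_cancel₀ hp
    apply mul_left_cancel₀ hp
    rw [← hN, ← hsmul]
    rfl

theorem sum_filter_dvd_eq_zero_of_not_dvd (hD : 0 < 4 * c - s ^ 2) {φ : ℤ × ℤ → ℤ} {p M : ℤ}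
    (hp : p ≠ 0) (hM : ¬ p ∣ M) :
    ∑ x ∈ (normReps s c (p * M)).filter (fun x ↦ p ∣ x.1 ∧ p ∣ x.2), φ x = 0 := by
  refine Finset.sum_eq_zero fun x hx ↦ (hM ?_).elim
  rw [Finset.mem_filter, mem_normReps hD] at hx
  obtain ⟨hN, ⟨a, ha⟩, ⟨b, hb⟩⟩ := hx
  refine ⟨normForm s c (a, b), ?_⟩
  apply mul_left_cancel₀ hp
  rw [← hN]
  simp only [normForm, ha, hb]
  ring

/-- Thue's lemma: every residue `t` modulo a prime `p` is a quotient `x / y` with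
`|x|, |y| < √p`. -/
theorem exists_sq_lt_dvd_sub {p : ℕ} (hp : p.Prime) (t : ℤ) :
    ∃ x : ℤ × ℤ, x ≠ 0 ∧ x.1 ^ 2 < p ∧ x.2 ^ 2 < p ∧ (p : ℤ) ∣ x.1 - t * x.2 := by
  have : NeZero p := ⟨hp.ne_zero⟩
  set r := p.sqrt with hr
  let f : Fin (r + 1) × Fin (r + 1) → ZMod p := fun x ↦ (x.1 : ℕ) - t * (x.2 : ℕ)
  obtain ⟨x, y, hxy, hf⟩ : ∃ x y, x ≠ y ∧ f x = f y := by
    apply Fintype.exists_ne_map_eq_of_card_lt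
    simpa [ZMod.card] using Nat.lt_succ_sqrt p
  have hsq : ∀ i j : Fin (r + 1), (((i : ℕ) : ℤ) - (j : ℕ)) ^ 2 < p := fun i j ↦ by
    have h1 : r * r < p := lt_of_le_of_ne (Nat.sqrt_le p) fun h ↦
      hp.prime.irreducible.not_isSquare ⟨r, h.symm⟩
    have h2 : (r : ℤ) * r < p := by exact_mod_cast h1
    have h3 := i.is_le
    have h4 := j.is_le
    zify at h3 h4
    nlinarith [Int.natCast_nonneg (i : ℕ), Int.natCast_nonneg (j : ℕ)]
  refine ⟨(((x.1 : ℕ) : ℤ) - (y.1 : ℕ), ((x.2 : ℕ) : ℤ) - (y.2 : ℕ)), ?_, hsq _ _, hsq _ _, ?_⟩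
  · intro h
    simp only [Prod.ext_iff, Prod.fst_zero, Prod.snd_zero, sub_eq_zero, Nat.cast_inj] at h
    exact hxy (Prod.ext (Fin.ext h.1) (Fin.ext h.2))
  · rw [← ZMod.intCast_zmod_eq_zero_iff_dvd]
    push_cast
    simp only [f] at hf
    linear_combination hf

/-- If `p` does not stay prime, then some multiple `k * p` with `k ≤ s + c` is a norm. -/
theorem exists_normForm_eq_mul (hs : 0 ≤ s) (hD : 0 < 4 * c - s ^ 2) {p : ℕ} (hp : p.Prime)
    (hsplit : ¬ ∀ x, (p : ℤ) ∣ normForm s c x → (p : ℤ) ∣ x.1 ∧ (p : ℤ) ∣ x.2) :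
    ∃ (k : ℤ) (x : ℤ × ℤ), 0 < k ∧ k ≤ s + c ∧ normForm s c x = k * p := by
  have hpp : Prime (p : ℤ) := Nat.prime_iff_prime_int.1 hp
  have : Fact p.Prime := ⟨hp⟩
  push Not at hsplit
  obtain ⟨⟨a, b⟩, hab, hnd⟩ := hsplit
  simp only [normForm] at hab hnd
  have hb : ¬ (p : ℤ) ∣ b := fun hb ↦ by
    refine hnd (hpp.dvd_of_dvd_pow (n := 2) ?_) hb
    obtain ⟨w, rfl⟩ := hb
    obtain ⟨z, hz⟩ := hab
    exact ⟨z - s * a * w - c * p * w ^ 2, by linear_combination hz⟩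
  obtain ⟨b', hb'⟩ : ∃ b' : ℤ, (p : ℤ) ∣ b * b' - 1 := by
    refine ⟨((b : ZMod p)⁻¹).val, ?_⟩
    rw [← ZMod.intCast_zmod_eq_zero_iff_dvd]
    have hb0 : (b : ZMod p) ≠ 0 := by rwa [Ne, ZMod.intCast_zmod_eq_zero_iff_dvd]
    simp [hb0]
  obtain ⟨x, hx0, hx1, hx2, hx⟩ := exists_sq_lt_dvd_sub hp (a * b')
  have hdvd : (p : ℤ) ∣ normForm s c x := by
    rw [← ZMod.intCast_zmod_eq_zero_iff_dvd] at hab hb' hx ⊢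
    simp only [normForm]
    push_cast at hab hb' hx ⊢
    linear_combination (x.1 + a * b' * x.2 + s * x.2) * hx + x.2 ^ 2 * b' ^ 2 * hab -
      (s * a * b' * x.2 ^ 2 + c * x.2 ^ 2 * (b * b' + 1)) * hb'
  obtain ⟨k, hk⟩ := hdvd
  have hpos := normForm_pos hD hx0
  have hp0 : (0 : ℤ) < p := by exact_mod_cast hp.pos
  have hc : 0 < c := by nlinarith [sq_nonneg s]
  have hk0 : 0 < k := by
    rw [hk] at hpos
    exact pos_of_mul_pos_right hpos hp0.le
  refine ⟨k, x, hk0, ?_, by rw [hk, mul_comm]⟩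
  have h1 : x.1 * x.2 < p := by nlinarith [sq_nonneg (x.1 - x.2)]
  have h2 : normForm s c x < (1 + s + c) * p := by
    simp only [normForm]
    nlinarith [mul_le_mul_of_nonneg_left h1.le hs, mul_lt_mul_of_pos_left hx2 hc]
  have h3 : k < 1 + s + c := by
    rw [hk, mul_comm] at h2
    exact lt_of_mul_lt_mul_right h2 hp0.le
  omega

/-! ### The Hecke relation and folding by the sign -/

theorem not_dvd_of_normForm_eq_mul {p : ℕ} (hp : p.Prime) {e u v : ℤ}
    (hπ : normForm s c (u, v) = e * p) (he : ¬ (p : ℤ) ∣ e) (hpD : ¬ (p : ℤ) ∣ 4 * c - s ^ 2) :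
    ¬ (p : ℤ) ∣ v ∧ ¬ (p : ℤ) ∣ 2 * u + s * v := by
  have hpp : Prime (p : ℤ) := Nat.prime_iff_prime_int.1 hp
  have h4 := four_mul_normForm s c (u, v)
  simp only [normForm] at hπ h4
  have hv : ¬ (p : ℤ) ∣ v := by
    rintro ⟨v, rfl⟩
    have hu : (p : ℤ) ∣ u := by
      refine hpp.dvd_of_dvd_pow (n := 2) ⟨e - s * u * v - c * p * v ^ 2, ?_⟩
      linear_combination hπ
    obtain ⟨u, rfl⟩ := hu
    refine he ⟨u ^ 2 + s * u * v + c * v ^ 2, ?_⟩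
    apply mul_left_cancel₀ hpp.ne_zero
    linear_combination -hπ
  refine ⟨hv, ?_⟩
  rintro ⟨t, ht⟩
  have h5 : (p : ℤ) ∣ (4 * c - s ^ 2) * v ^ 2 := by
    refine ⟨4 * e - p * t ^ 2, ?_⟩
    linear_combination 4 * hπ - h4 - (2 * u + s * v + p * t) * ht
  exact (hpp.dvd_or_dvd h5).elim hpD fun h ↦ hv (hpp.dvd_of_dvd_pow h)

/-- The Hecke relation, in the form needed here: the theta coefficient at `p * M` vanishes as soon
as the part of it that comes from the elements divisible by `p` does. -/
theorem thetaCoeff_eq_zero_of_sum_filter (hD : 0 < 4 * c - s ^ 2) {φ : ℤ × ℤ → ℤ} {p : ℕ}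
    (hp : p.Prime) {M : ℤ} (hφ : ∀ x, φ (conjPair s x) = φ x)
    (hsplit : (¬ ∀ x, (p : ℤ) ∣ normForm s c x → (p : ℤ) ∣ x.1 ∧ (p : ℤ) ∣ x.2) →
      ∃ e u v : ℤ, e ≠ 0 ∧ normForm s c (u, v) = e * p ∧ ¬ (p : ℤ) ∣ v ∧ ¬ (p : ℤ) ∣ 2 * u + s * v ∧
        ∀ y, normForm s c y = e * M → ∃ z z' : ℤ × ℤ, mulPair s c y (u, v) = e • z ∧
          mulPair s c (conjPair s y) (u, v) = e • z' ∧ φ z + φ z' = 0)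
    (h : ∑ x ∈ (normReps s c (p * M)).filter (fun x ↦ (p : ℤ) ∣ x.1 ∧ (p : ℤ) ∣ x.2), φ x = 0) :
    thetaCoeff s c φ (p * M) = 0 := by
  by_cases hinert : ∀ x, (p : ℤ) ∣ normForm s c x → (p : ℤ) ∣ x.1 ∧ (p : ℤ) ∣ x.2
  · rw [thetaCoeff_eq_sum_filter_dvd hD hinert, h]
  · obtain ⟨e, u, v, he, hπ, hv, huv, hy⟩ := hsplit hinert
    rw [thetaCoeff_eq_neg_sum_filter_dvd hD hp hπ hv huv (fun x _ ↦ hφ x)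
      (sum_filter_dvd_eq_zero hD φ hp he hπ hv hy), h, neg_zero]

/-- The case `π = -1 + ω` of `sum_filter_dvd_eq_zero`, where the elements in question are those with
`q ∣ a + b`, and the case of a norm `N` prime to `q`, where there are none. -/
theorem sum_filter_dvd_add_eq_zero (hD : 0 < 4 * c - s ^ 2) (φ : ℤ × ℤ → ℤ) {q : ℕ} (hq : q.Prime)
    {e N : ℤ} (he : e ≠ 0) (hπ : 1 - s + c = e * q)
    (hφ : ∀ M, N = q * M → ∀ y, normForm s c y = e * M → ∃ z z' : ℤ × ℤ,
      mulPair s c y (-1, 1) = e • z ∧ mulPair s c (conjPair s y) (-1, 1) = e • z' ∧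
        φ z + φ z' = 0) :
    ∑ x ∈ (normReps s c N).filter (fun x ↦ (q : ℤ) ∣ x.1 + x.2), φ x = 0 := by
  by_cases hN : (q : ℤ) ∣ N
  · obtain ⟨M, rfl⟩ := hN
    rw [← sum_filter_dvd_eq_zero hD φ hq he (u := -1) (v := 1) (M := M)
      (by simp only [normForm]; linear_combination hπ)
      (fun h ↦ hq.one_lt.ne' (by exact_mod_cast Int.eq_one_of_dvd_one (by positivity) h))
      (hφ M rfl)]
    congr 1
    refine Finset.filter_congr fun x _ ↦ ?_
    rw [← dvd_neg]
    ring_nf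
  · refine Finset.sum_eq_zero fun x hx ↦ (hN ?_).elim
    rw [Finset.mem_filter, mem_normReps hD] at hx
    obtain ⟨rfl, t, ht⟩ := hx
    refine ⟨t * (x.1 + (s - 1) * x.2) + e * x.2 ^ 2, ?_⟩
    simp only [normForm]
    linear_combination (x.1 + (s - 1) * x.2) * ht + x.2 ^ 2 * hπ

/-- Folding the theta coefficient by `x ↦ -x`. -/
theorem thetaCoeff_eq_two_mul (hD : 0 < 4 * c - s ^ 2) {φ : ℤ × ℤ → ℤ} {q : ℕ} {N : ℤ}
    (g : ℤ × ℤ → ℤ) (hg : ∀ x, g (-x) = -g x) (hφ : ∀ x, φ (-x) = φ x)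
    (h0 : ∑ x ∈ (normReps s c N).filter (fun x ↦ (q : ℤ) ∣ x.1 + x.2), φ x = 0)
    (hg0 : ∀ x, normForm s c x = N → ¬ (q : ℤ) ∣ x.1 + x.2 → g x % 3 = 0 → φ x = 0) :
    thetaCoeff s c φ N = 2 *
      ∑ x ∈ (normReps s c N).filter (fun x ↦ ¬ (q : ℤ) ∣ x.1 + x.2 ∧ g x % 3 = 2), φ x := by
  have h1 : ∑ x ∈ (normReps s c N).filter (fun x ↦ ¬ (q : ℤ) ∣ x.1 + x.2 ∧ g x % 3 = 1), φ x =
      ∑ x ∈ (normReps s c N).filter (fun x ↦ ¬ (q : ℤ) ∣ x.1 + x.2 ∧ g x % 3 = 2), φ x := by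
    have hneg : ∀ x, normForm s c (-x) = normForm s c x := fun x ↦ by
      simp only [normForm, Prod.fst_neg, Prod.snd_neg]; ring
    have hdvd : ∀ x : ℤ × ℤ, (q : ℤ) ∣ (-x).1 + (-x).2 ↔ (q : ℤ) ∣ x.1 + x.2 := fun x ↦ by
      rw [← dvd_neg, Prod.fst_neg, Prod.snd_neg]; ring_nf
    refine Finset.sum_nbij' (-·) (-·) ?_ ?_ (fun x _ ↦ neg_neg x) (fun x _ ↦ neg_neg x)
      (fun x _ ↦ (hφ x).symm)
    · intro x hx
      rw [Finset.mem_filter, mem_normReps hD] at hx ⊢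
      rw [hneg, hdvd, hg]
      exact ⟨hx.1, hx.2.1, by omega⟩
    · intro x hx
      rw [Finset.mem_filter, mem_normReps hD] at hx ⊢
      rw [hneg, hdvd, hg]
      exact ⟨hx.1, hx.2.1, by omega⟩
  have h2 := Finset.sum_filter_add_sum_filter_not (normReps s c N)
    (fun x ↦ (q : ℤ) ∣ x.1 + x.2) φ
  have h3 := Finset.sum_filter_add_sum_filter_not
    ((normReps s c N).filter fun x ↦ ¬ (q : ℤ) ∣ x.1 + x.2) (fun x ↦ g x % 3 = 2) φ
  have h4 : ∑ x ∈ ((normReps s c N).filter fun x ↦ ¬ (q : ℤ) ∣ x.1 + x.2).filter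
      (fun x ↦ ¬ g x % 3 = 2), φ x =
      ∑ x ∈ (normReps s c N).filter (fun x ↦ ¬ (q : ℤ) ∣ x.1 + x.2 ∧ g x % 3 = 1), φ x := by
    symm
    rw [Finset.filter_filter]
    refine Finset.sum_subset (fun x hx ↦ ?_) (fun x hx hx' ↦ ?_)
    · rw [Finset.mem_filter] at hx ⊢
      exact ⟨hx.1, hx.2.1, by omega⟩
    · rw [Finset.mem_filter] at hx hx'
      refine hg0 x ((mem_normReps hD).1 hx.1) hx.2.1 ?_
      by_contra h
      exact hx' ⟨hx.1, hx.2.1, by omega⟩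
  rw [Finset.filter_filter] at h3
  rw [h4, h1] at h3
  unfold thetaCoeff
  omega

theorem coe_negOnePow_eq_ite (n : ℤ) : (n.negOnePow : ℤ) = if 2 ∣ n then 1 else -1 := by
  split_ifs with h
  · rw [Int.negOnePow_even n (even_iff_two_dvd.2 h)]; rfl
  · rw [Int.negOnePow_odd n (Int.not_even_iff_odd.1 (mt even_iff_two_dvd.1 h))]; rfl

theorem intCast_eq_one_iff (m : ℕ) (N : ℤ) : (N : ZMod m) = 1 ↔ (m : ℤ) ∣ N - 1 := by
  rw [← ZMod.intCast_zmod_eq_zero_iff_dvd]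
  push_cast
  exact sub_eq_zero.symm

/-! ### The form `a ^ 2 + 5 * b ^ 2` -/

/-- The weight `(-1) ^ b`. -/
def weightFive (x : ℤ × ℤ) : ℤ := if 2 ∣ x.2 then 1 else -1

/-- If `y = (a, b)` and `π = (u, v)` have norms twice an odd number, then `a`, `b`, `u`, `v` are
odd, and the second coordinates of `y * π / 2` and `conj y * π / 2` add up to the odd
number `a * v`. -/
theorem weightFive_pair {M u v : ℤ} (hM : Odd M) {q : ℤ} (hq : Odd q)
    (hπ : normForm 0 5 (u, v) = 2 * q) (y : ℤ × ℤ) (hy : normForm 0 5 y = 2 * M) :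
    ∃ z z' : ℤ × ℤ, mulPair 0 5 y (u, v) = (2 : ℤ) • z ∧
      mulPair 0 5 (conjPair 0 y) (u, v) = (2 : ℤ) • z' ∧ weightFive z + weightFive z' = 0 := by
  have key : ∀ a b q : ℤ, Odd q → normForm 0 5 (a, b) = 2 * q → Odd a ∧ Odd b := by
    rintro a b q ⟨r, rfl⟩ h
    simp only [normForm] at h
    rcases Int.even_or_odd' a with ⟨a, rfl | rfl⟩ <;> rcases Int.even_or_odd' b with ⟨b, rfl | rfl⟩
    · ring_nf at h; omega
    · ring_nf at h; omega
    · ring_nf at h; omega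
    · exact ⟨⟨a, rfl⟩, ⟨b, rfl⟩⟩
  obtain ⟨a, b⟩ := y
  obtain ⟨⟨a, rfl⟩, ⟨b, rfl⟩⟩ := key a b M hM hy
  obtain ⟨⟨u, rfl⟩, ⟨v, rfl⟩⟩ := key u v q hq hπ
  refine ⟨(2 * a * u + a + u - 10 * b * v - 5 * b - 5 * v - 2,
      2 * a * v + a + v + 2 * b * u + b + u + 1),
    (2 * a * u + a + u + 10 * b * v + 5 * b + 5 * v + 3,
      2 * a * v + a + v - 2 * b * u - b - u), ?_, ?_, ?_⟩
  · ext <;> simp only [mulPair, Prod.smul_fst, Prod.smul_snd, smul_eq_mul] <;> ring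
  · ext <;> simp only [mulPair, conjPair, Prod.smul_fst, Prod.smul_snd, smul_eq_mul] <;> ring
  · simp only [weightFive]
    simp only [mul_assoc]
    generalize a * v = z
    generalize b * u = w
    split_ifs <;> omega

/-- A prime that splits in `ℤ[√-5]` and is `3` modulo `4` lies below non-principal prime ideals, so
it is `2 * p`, and not `p`, that is a norm. -/
theorem exists_normForm_eq_two_mul {p : ℕ} (hp : p.Prime) (hp4 : p % 4 = 3)
    (hsplit : ¬ ∀ x, (p : ℤ) ∣ normForm 0 5 x → (p : ℤ) ∣ x.1 ∧ (p : ℤ) ∣ x.2) :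
    ∃ x, normForm 0 5 x = 2 * p := by
  obtain ⟨k, ⟨a, b⟩, hk0, hk5, hk⟩ := exists_normForm_eq_mul le_rfl (by norm_num) hp hsplit
  have hne : ∀ a b : ℤ, a ^ 2 + 5 * b ^ 2 ≠ p := fun a b h ↦ by
    have h4 : (p : ℤ) % 4 = 3 := by exact_mod_cast hp4
    rcases Int.even_or_odd' a with ⟨a, rfl | rfl⟩ <;>
      rcases Int.even_or_odd' b with ⟨b, rfl | rfl⟩ <;> ring_nf at h <;> omega
  simp only [normForm, zero_mul, add_zero] at hk ⊢
  have : k = 1 ∨ k = 2 ∨ k = 3 ∨ k = 4 ∨ k = 5 := by omega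
  rcases this with rfl | rfl | rfl | rfl | rfl
  · exact (hne a b (by linarith)).elim
  · exact ⟨(a, b), hk⟩
  · -- multiply by `1 + √-5` or its conjugate and divide by `3`
    have h3 : (3 : ℤ) ∣ a - b ∨ (3 : ℤ) ∣ a + b := by
      apply Int.prime_three.dvd_or_dvd
      exact ⟨p - 2 * b ^ 2, by linear_combination hk⟩
    rcases h3 with ⟨t, ht⟩ | ⟨t, ht⟩
    · obtain rfl : a = b + 3 * t := by linarith
      exact ⟨(2 * b + t, t), by linarith⟩
    · obtain rfl : a = 3 * t - b := by linarith
      exact ⟨(2 * b - t, t), by linarith⟩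
  · rcases Int.even_or_odd' a with ⟨a, rfl | rfl⟩ <;>
      rcases Int.even_or_odd' b with ⟨b, rfl | rfl⟩
    · exact (hne a b (by linarith)).elim
    all_goals ring_nf at hk; omega
  · have h5 : (5 : ℤ) ∣ a := by
      refine (Nat.prime_iff_prime_int.1 Nat.prime_five).dvd_of_dvd_pow (n := 2) ?_
      exact ⟨p - b ^ 2, by push_cast; linear_combination hk⟩
    obtain ⟨a, rfl⟩ := h5
    exact (hne b a (by linarith)).elim

theorem weightFive_smul {p : ℤ} (hp : Odd p) (x : ℤ × ℤ) : weightFive (p • x) = weightFive x := by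
  have : (2 : ℤ) ∣ p * x.2 ↔ 2 ∣ x.2 := by
    refine ⟨fun h ↦ (Int.prime_two.dvd_or_dvd h).resolve_left ?_, fun h ↦ h.mul_left p⟩
    rwa [← even_iff_two_dvd, Int.not_even_iff_odd]
  simp [weightFive, this]

theorem thetaCoeff_five_mul {p : ℕ} (hp : p.Prime) (hp4 : p % 4 = 3) {M : ℤ}
    (hM : ((p * M : ℤ) : ZMod 4) = 1)
    (h : ∑ x ∈ (normReps 0 5 (p * M)).filter (fun x ↦ (p : ℤ) ∣ x.1 ∧ (p : ℤ) ∣ x.2),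
      weightFive x = 0) :
    thetaCoeff 0 5 weightFive (p * M) = 0 := by
  refine thetaCoeff_eq_zero_of_sum_filter (by norm_num) hp (fun x ↦ by simp [weightFive, conjPair])
    (fun hsplit ↦ ?_) h
  obtain ⟨⟨u, v⟩, hπ⟩ := exists_normForm_eq_two_mul hp hp4 hsplit
  have hpodd : Odd (p : ℤ) := by
    rw [Int.odd_iff]; omega
  obtain ⟨hv, hu⟩ := not_dvd_of_normForm_eq_mul hp hπ
    (fun h ↦ by
      have : p ∣ 2 := by exact_mod_cast h
      rw [Nat.prime_dvd_prime_iff_eq hp Nat.prime_two] at this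
      omega)
    (fun h ↦ by
      rw [show (4 * 5 - 0 ^ 2 : ℤ) = ((2 ^ 2 * 5 : ℕ) : ℤ) by norm_num,
        Int.natCast_dvd_natCast] at h
      rcases hp.dvd_mul.1 h with h | h
      · rw [(Nat.prime_dvd_prime_iff_eq hp Nat.prime_two).1 (hp.dvd_of_dvd_pow h)] at hp4
        omega
      · rw [(Nat.prime_dvd_prime_iff_eq hp Nat.prime_five).1 h] at hp4
        omega)
  have hModd : Odd M := by
    rw [intCast_eq_one_iff] at hM
    push_cast at hM
    have : Odd (p * M : ℤ) := by rw [Int.odd_iff]; omega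
    exact (Int.odd_mul.1 this).2
  exact ⟨2, u, v, two_ne_zero, hπ, hv, hu, fun y hy ↦ weightFive_pair hModd hpodd hπ y hy⟩

/-- The substitution `x = a - 5 * b`, `y = a + b` turns `x ^ 2 + 5 * y ^ 2 = 6 * N` into
`a ^ 2 + 5 * b ^ 2 = N`; here `x = 6 * k - 1` and `y = 6 * l - 1` come from completing the square in
the pentagonal numbers. -/
theorem thetaCoeff_five_eq (n : ℕ) :
    thetaCoeff 0 5 weightFive (4 * n + 1) =
      2 * ∑ x ∈ pentagonalPairs 5 n, ((x.1 + x.2).negOnePow : ℤ) := by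
  have hD : (0 : ℤ) < 4 * 5 - 0 ^ 2 := by norm_num
  have hpar : ∀ a b : ℤ, normForm 0 5 (a, b) = 4 * n + 1 → (a + b) % 2 = 1 := fun a b h ↦ by
    simp only [normForm] at h
    rcases Int.even_or_odd' a with ⟨a, rfl | rfl⟩ <;>
      rcases Int.even_or_odd' b with ⟨b, rfl | rfl⟩ <;> ring_nf at h <;> omega
  rw [thetaCoeff_eq_two_mul hD (q := 3) (fun x ↦ x.1 + x.2)
    (fun x ↦ by simp only [Prod.fst_neg, Prod.snd_neg]; ring) (fun x ↦ by simp [weightFive])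
    ?_ (fun x _ h h' ↦ by omega)]
  · congr 1
    symm
    refine Finset.sum_nbij (fun x ↦ (5 * x.2 + x.1 - 1, x.2 - x.1)) ?_ ?_ ?_ ?_
    · rintro ⟨k, l⟩ hx
      rw [mem_pentagonalPairs (by norm_num)] at hx
      rw [Finset.mem_filter, mem_normReps hD]
      refine ⟨?_, by push_cast; omega⟩
      simp only [normForm]
      push_cast at hx
      linarith
    · rintro ⟨k, l⟩ - ⟨k', l'⟩ - h
      simp only [Prod.mk.injEq] at h ⊢
      omega
    · rintro ⟨a, b⟩ hx
      rw [Finset.mem_coe, Finset.mem_filter, mem_normReps hD] at hx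
      obtain ⟨hN, -, h3⟩ := hx
      simp only at h3
      have h2 := hpar a b hN
      obtain ⟨l, hl⟩ : ∃ l, a + b = 6 * l - 1 := ⟨(a + b + 1) / 6, by omega⟩
      obtain rfl : a = 6 * l - 1 - b := by linarith
      refine ⟨(l - b, l), ?_, by ext <;> simp only <;> ring⟩
      rw [Finset.mem_coe, mem_pentagonalPairs (by norm_num)]
      simp only [normForm] at hN
      push_cast
      linarith
    · rintro ⟨k, l⟩ -
      rw [coe_negOnePow_eq_ite, weightFive]
      simp only
      congr 1
      rw [eq_iff_iff]
      omega
  · refine sum_filter_dvd_add_eq_zero hD _ Nat.prime_three two_ne_zero (by norm_num)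
      fun M hM y hy ↦ weightFive_pair (q := 3) ?_ (by decide) (by norm_num [normForm]) y hy
    rw [Int.odd_iff]
    push_cast at hM
    omega

/-! ### The form `a ^ 2 + 2 * b ^ 2` -/

/-- The weight `(-1) ^ (b / 2)`; the junk value at odd `b` plays no role, since `b` is even when the
norm is `1` modulo `8`. -/
def weightTwo (x : ℤ × ℤ) : ℤ := if 4 ∣ x.2 then 1 else -1

theorem weightTwo_smul {p : ℤ} (hp : Odd p) (x : ℤ × ℤ) : weightTwo (p • x) = weightTwo x := by
  have h4 : IsCoprime (4 : ℤ) p := by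
    obtain ⟨r, rfl⟩ := hp
    exact ⟨-(r ^ 2 + r), 2 * r + 1, by ring⟩
  have : (4 : ℤ) ∣ p * x.2 ↔ 4 ∣ x.2 := ⟨h4.dvd_of_dvd_mul_left, fun h ↦ h.mul_left p⟩
  simp [weightTwo, this]

theorem odd_of_normForm_two {a b N : ℤ} (hN : N % 8 = 3) (h : normForm 0 2 (a, b) = N) :
    Odd a ∧ Odd b := by
  simp only [normForm] at h
  rcases Int.even_or_odd' a with ⟨a, rfl | rfl⟩ <;> rcases Int.even_or_odd' b with ⟨b, rfl | rfl⟩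
  · ring_nf at h; omega
  · ring_nf at h; omega
  · ring_nf at h
    have := Int.even_mul_succ_self a
    rw [even_iff_two_dvd] at this
    ring_nf at this
    omega
  · exact ⟨⟨a, rfl⟩, ⟨b, rfl⟩⟩

/-- All of `u`, `v`, `a`, `b` are odd, and exactly one of `a * v + b * u` and `a * v - b * u` is
divisible by `4`. -/
theorem weightTwo_pair {M q u v : ℤ} (hM : M % 8 = 3) (hq : q % 8 = 3)
    (hπ : normForm 0 2 (u, v) = 1 * q) (y : ℤ × ℤ) (hy : normForm 0 2 y = 1 * M) :
    ∃ z z' : ℤ × ℤ, mulPair 0 2 y (u, v) = (1 : ℤ) • z ∧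
      mulPair 0 2 (conjPair 0 y) (u, v) = (1 : ℤ) • z' ∧ weightTwo z + weightTwo z' = 0 := by
  obtain ⟨a, b⟩ := y
  rw [one_mul] at hπ hy
  obtain ⟨⟨a, rfl⟩, ⟨b, rfl⟩⟩ := odd_of_normForm_two hM hy
  obtain ⟨⟨u, rfl⟩, ⟨v, rfl⟩⟩ := odd_of_normForm_two hq hπ
  refine ⟨_, _, (one_smul ..).symm, (one_smul ..).symm, ?_⟩
  -- the two second coordinates are even and their sum is `2` modulo `4`
  have h1 : (mulPair 0 2 (2 * a + 1, 2 * b + 1) (2 * u + 1, 2 * v + 1)).2 =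
      4 * (a * v + b * u) + 2 * (a + v + b + u + 1) := by
    simp only [mulPair]; ring
  have h2 : (mulPair 0 2 (conjPair 0 (2 * a + 1, 2 * b + 1)) (2 * u + 1, 2 * v + 1)).2 =
      4 * (a * v - b * u) + 2 * (a + v - b - u) := by
    simp only [mulPair, conjPair]; ring
  simp only [weightTwo, h1, h2]
  split_ifs <;> omega

theorem exists_normForm_two_eq {p : ℕ} (hp : p.Prime)
    (hsplit : ¬ ∀ x, (p : ℤ) ∣ normForm 0 2 x → (p : ℤ) ∣ x.1 ∧ (p : ℤ) ∣ x.2) :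
    ∃ x, normForm 0 2 x = p := by
  obtain ⟨k, ⟨a, b⟩, hk0, hk2, hk⟩ := exists_normForm_eq_mul le_rfl (by norm_num) hp hsplit
  have : k = 1 ∨ k = 2 := by omega
  simp only [normForm, zero_mul, add_zero] at hk ⊢
  rcases this with rfl | rfl
  · exact ⟨(a, b), by linarith⟩
  · have h2 : (2 : ℤ) ∣ a := by
      refine Int.prime_two.dvd_of_dvd_pow (n := 2) ?_
      exact ⟨p - b ^ 2, by linear_combination hk⟩
    obtain ⟨a, rfl⟩ := h2
    exact ⟨(b, a), by linarith⟩

theorem thetaCoeff_two_mul {p : ℕ} (hp : p.Prime) (hp8 : ¬ p % 8 = 1) {M : ℤ}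
    (hM : ((p * M : ℤ) : ZMod 8) = 1)
    (h : ∑ x ∈ (normReps 0 2 (p * M)).filter (fun x ↦ (p : ℤ) ∣ x.1 ∧ (p : ℤ) ∣ x.2),
      weightTwo x = 0) :
    thetaCoeff 0 2 weightTwo (p * M) = 0 := by
  refine thetaCoeff_eq_zero_of_sum_filter (by norm_num) hp (fun x ↦ by simp [weightTwo, conjPair])
    (fun hsplit ↦ ?_) h
  rw [intCast_eq_one_iff] at hM
  push_cast at hM
  have hpodd : Odd (p : ℤ) := by
    have : Odd (p * M : ℤ) := by rw [Int.odd_iff]; omega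
    exact (Int.odd_mul.1 this).1
  obtain ⟨⟨u, v⟩, hπ⟩ := exists_normForm_two_eq hp hsplit
  have hp3 : (p : ℤ) % 8 = 3 := by
    have h1 : ¬ (p : ℤ) % 8 = 1 := by omega
    simp only [normForm] at hπ
    rw [Int.odd_iff] at hpodd
    rcases Int.even_or_odd' u with ⟨u, rfl | rfl⟩ <;>
      rcases Int.even_or_odd' v with ⟨v, rfl | rfl⟩
    · ring_nf at hπ; omega
    · ring_nf at hπ; omega
    · have := Int.even_mul_succ_self u
      rw [even_iff_two_dvd] at this
      ring_nf at hπ this; omega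
    · have := Int.even_mul_succ_self u
      have h2 := Int.even_mul_succ_self v
      rw [even_iff_two_dvd] at this h2
      ring_nf at hπ this h2; omega
  have hM3 : M % 8 = 3 := by
    obtain ⟨r, hr⟩ : ∃ r, (p : ℤ) = 8 * r + 3 := ⟨p / 8, by omega⟩
    rw [hr, add_mul, mul_assoc] at hM
    omega
  rw [← one_mul (p : ℤ)] at hπ
  obtain ⟨hv, hu⟩ := not_dvd_of_normForm_eq_mul hp hπ
    (Nat.prime_iff_prime_int.1 hp).not_dvd_one
    (fun h ↦ by
      rw [show (4 * 2 - 0 ^ 2 : ℤ) = ((2 ^ 3 : ℕ) : ℤ) by norm_num, Int.natCast_dvd_natCast] at h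
      rw [(Nat.prime_dvd_prime_iff_eq hp Nat.prime_two).1 (hp.dvd_of_dvd_pow h)] at hp3
      omega)
  exact ⟨1, u, v, one_ne_zero, hπ, hv, hu, fun y hy ↦ weightTwo_pair hM3 hp3 hπ y hy⟩

/-- The substitution `x = a - 2 * b`, `y = a + b` turns `x ^ 2 + 2 * y ^ 2 = 3 * N` into
`a ^ 2 + 2 * b ^ 2 = N`, with `x = 6 * k - 1` and `y = 6 * l - 1`. -/
theorem thetaCoeff_two_eq (n : ℕ) :
    thetaCoeff 0 2 weightTwo (8 * n + 1) =
      2 * ∑ x ∈ pentagonalPairs 2 n, ((x.1 + x.2).negOnePow : ℤ) := by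
  have hD : (0 : ℤ) < 4 * 2 - 0 ^ 2 := by norm_num
  have hpar : ∀ a b : ℤ, normForm 0 2 (a, b) = 8 * n + 1 → a % 2 = 1 ∧ b % 2 = 0 := fun a b h ↦ by
    simp only [normForm] at h
    rcases Int.even_or_odd' a with ⟨a, rfl | rfl⟩ <;>
      rcases Int.even_or_odd' b with ⟨b, rfl | rfl⟩
    · ring_nf at h; omega
    · ring_nf at h; omega
    · omega
    · have := Int.even_mul_succ_self a
      rw [even_iff_two_dvd] at this
      ring_nf at h this; omega
  rw [thetaCoeff_eq_two_mul hD (q := 3) (fun x ↦ x.1 + x.2)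
    (fun x ↦ by simp only [Prod.fst_neg, Prod.snd_neg]; ring) (fun x ↦ by simp [weightTwo])
    ?_ (fun x _ h h' ↦ by omega)]
  · congr 1
    symm
    refine Finset.sum_nbij (fun x ↦ (4 * x.2 + 2 * x.1 - 1, 2 * (x.2 - x.1))) ?_ ?_ ?_ ?_
    · rintro ⟨k, l⟩ hx
      rw [mem_pentagonalPairs (by norm_num)] at hx
      rw [Finset.mem_filter, mem_normReps hD]
      refine ⟨?_, by push_cast; omega⟩
      simp only [normForm]
      push_cast at hx
      linarith
    · rintro ⟨k, l⟩ - ⟨k', l'⟩ - h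
      simp only [Prod.mk.injEq] at h ⊢
      omega
    · rintro ⟨a, b⟩ hx
      rw [Finset.mem_coe, Finset.mem_filter, mem_normReps hD] at hx
      obtain ⟨hN, -, h3⟩ := hx
      simp only at h3
      obtain ⟨ha, hb⟩ := hpar a b hN
      obtain ⟨b, rfl⟩ : ∃ b', b = 2 * b' := ⟨b / 2, by omega⟩
      obtain ⟨l, hl⟩ : ∃ l, a + 2 * b = 6 * l - 1 := ⟨(a + 2 * b + 1) / 6, by omega⟩
      obtain rfl : a = 6 * l - 1 - 2 * b := by linarith
      refine ⟨(l - b, l), ?_, by ext <;> simp only <;> ring⟩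
      rw [Finset.mem_coe, mem_pentagonalPairs (by norm_num)]
      simp only [normForm] at hN
      push_cast
      linarith
    · rintro ⟨k, l⟩ -
      rw [coe_negOnePow_eq_ite, weightTwo]
      simp only
      congr 1
      rw [eq_iff_iff]
      omega
  · refine sum_filter_dvd_add_eq_zero hD _ Nat.prime_three one_ne_zero (by norm_num)
      fun M hM y hy ↦ weightTwo_pair (q := 3) ?_ (by norm_num) (by norm_num [normForm]) y hy
    push_cast at hM
    omega

/-! ### The form `a ^ 2 + a * b + 2 * b ^ 2` -/

/-- The weight `(a * (a + b) / 3)`, a Legendre symbol. -/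
noncomputable def weightSeven (x : ℤ × ℤ) : ℤ :=
  have : Fact (Nat.Prime 3) := ⟨Nat.prime_three⟩
  quadraticChar (ZMod 3) (x.1 * (x.1 + x.2))

theorem weightSeven_neg (x : ℤ × ℤ) : weightSeven (-x) = weightSeven x := by
  simp only [weightSeven, Prod.fst_neg, Prod.snd_neg]
  congr 1
  push_cast
  ring

theorem weightSeven_conjPair (x : ℤ × ℤ) : weightSeven (conjPair 1 x) = weightSeven x := by
  simp only [weightSeven, conjPair]
  congr 1
  push_cast
  ring

theorem weightSeven_smul {p : ℤ} (hp : (p : ZMod 3) ≠ 0) (x : ℤ × ℤ) :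
    weightSeven (p • x) = weightSeven x := by
  have : Fact (Nat.Prime 3) := ⟨Nat.prime_three⟩
  simp only [weightSeven, Prod.smul_fst, Prod.smul_snd, smul_eq_mul]
  rw [← one_mul (quadraticChar (ZMod 3) (x.1 * (x.1 + x.2))), ← quadraticChar_sq_one' hp, ← map_mul]
  congr 1
  push_cast
  ring

theorem weightSeven_eq (x : ℤ × ℤ) : weightSeven x =
    if (x.1 * (x.1 + x.2) : ZMod 3) = 0 then 0
    else if (x.1 * (x.1 + x.2) : ZMod 3) = 1 then 1 else -1 := by
  have key : ∀ r : ZMod 3, (have : Fact (Nat.Prime 3) := ⟨Nat.prime_three⟩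
      quadraticChar (ZMod 3) r) = if r = 0 then 0 else if r = 1 then 1 else -1 := by
    decide
  exact key _

/-- On the cyclic group `𝔽₉ˣ` of residues modulo `3`, the weight is the real part of a character
`χ` of order `4`. An element `π` whose norm is `2` modulo `3` has `χ π = ± i` and `χ (conj π) = -χ π`,
so that `y * π` and `y * conj π`, the latter conjugate to `conj y * π`, have opposite weights. -/
theorem weightSeven_pair {q u v : ℤ} (hq : q % 3 = 2) (hπ : normForm 1 2 (u, v) = 1 * q)
    (y : ℤ × ℤ) :
    ∃ z z' : ℤ × ℤ, mulPair 1 2 y (u, v) = (1 : ℤ) • z ∧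
      mulPair 1 2 (conjPair 1 y) (u, v) = (1 : ℤ) • z' ∧ weightSeven z + weightSeven z' = 0 := by
  refine ⟨_, _, (one_smul ..).symm, (one_smul ..).symm, ?_⟩
  have key : ∀ a b u v : ZMod 3, u * u + u * v + 2 * v * v = 2 →
      ((if (a * u - 2 * b * v) * (a * u - 2 * b * v + (a * v + b * u + b * v)) = 0 then (0 : ℤ)
        else if (a * u - 2 * b * v) * (a * u - 2 * b * v + (a * v + b * u + b * v)) = 1
        then 1 else -1) +
      if ((a + b) * u + 2 * b * v) * ((a + b) * u + 2 * b * v + ((a + b) * v - b * u - b * v)) = 0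
      then 0 else
      if ((a + b) * u + 2 * b * v) * ((a + b) * u + 2 * b * v + ((a + b) * v - b * u - b * v)) = 1
        then 1 else -1) = 0 := by
    decide
  have h := key y.1 y.2 u v ?_
  · rw [weightSeven_eq, weightSeven_eq]
    convert! h using 2
    · simp only [mulPair]
      push_cast
      simp
    · simp only [mulPair, conjPair]
      push_cast
      ring_nf
  · have h3 : (q : ZMod 3) = 2 := by
      rw [← sub_eq_zero, ← Int.cast_ofNat, ← Int.cast_sub, ZMod.intCast_zmod_eq_zero_iff_dvd]
      push_cast
      omega
    have h4 : ((normForm 1 2 (u, v) : ℤ) : ZMod 3) = 2 := by rw [hπ, one_mul, h3]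
    rw [normForm] at h4
    push_cast at h4
    linear_combination h4

theorem exists_normForm_seven_eq {p : ℕ} (hp : p.Prime) (hp3 : p ≠ 3)
    (hsplit : ¬ ∀ x, (p : ℤ) ∣ normForm 1 2 x → (p : ℤ) ∣ x.1 ∧ (p : ℤ) ∣ x.2) :
    ∃ x, normForm 1 2 x = p := by
  obtain ⟨k, ⟨a, b⟩, hk0, hk2, hk⟩ := exists_normForm_eq_mul zero_le_one (by norm_num) hp hsplit
  have : k = 1 ∨ k = 2 ∨ k = 3 := by omega
  simp only [normForm] at hk ⊢
  rcases this with rfl | rfl | rfl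
  · exact ⟨(a, b), by linarith⟩
  · have h2 : (2 : ℤ) ∣ a ∨ (2 : ℤ) ∣ a + b := by
      apply Int.prime_two.dvd_or_dvd
      exact ⟨p - b ^ 2, by linear_combination hk⟩
    rcases h2 with ⟨t, rfl⟩ | ⟨t, ht⟩
    · exact ⟨(b, t), by linarith⟩
    · obtain rfl : a = 2 * t - b := by linarith
      exact ⟨(b, -t), by linarith⟩
  · -- modulo `3` the form is `(a - b) ^ 2 + b ^ 2`, which is anisotropic
    have key : ∀ a b : ZMod 3, a * a + a * b + 2 * b * b = 0 → a = 0 ∧ b = 0 := by decide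
    obtain ⟨ha, hb⟩ := key a b (by
      have := congrArg (Int.cast : ℤ → ZMod 3) hk
      push_cast at this
      rw [show (3 : ZMod 3) = 0 from rfl] at this
      linear_combination this)
    rw [ZMod.intCast_zmod_eq_zero_iff_dvd] at ha hb
    obtain ⟨a, rfl⟩ := ha
    obtain ⟨b, rfl⟩ := hb
    have : (3 : ℤ) ∣ p := ⟨a ^ 2 + a * b + 2 * b ^ 2, by push_cast at hk; linarith⟩
    have : 3 ∣ p := by exact_mod_cast this
    rw [Nat.prime_dvd_prime_iff_eq Nat.prime_three hp] at this
    exact (hp3 this.symm).elim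

theorem thetaCoeff_seven_mul {p : ℕ} (hp : p.Prime) (hp3 : ¬ p % 3 = 1) {M : ℤ}
    (hM : ((p * M : ℤ) : ZMod 3) = 1)
    (h : ∑ x ∈ (normReps 1 2 (p * M)).filter (fun x ↦ (p : ℤ) ∣ x.1 ∧ (p : ℤ) ∣ x.2),
      weightSeven x = 0) :
    thetaCoeff 1 2 weightSeven (p * M) = 0 := by
  refine thetaCoeff_eq_zero_of_sum_filter (by norm_num) hp weightSeven_conjPair
    (fun hsplit ↦ ?_) h
  rw [intCast_eq_one_iff] at hM
  push_cast at hM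
  have hp32 : (p : ℤ) % 3 = 2 := by
    have h1 : ¬ (p : ℤ) % 3 = 1 := by omega
    -- `p = 3` is excluded because `p * M` is `1` modulo `3`
    have h0 : ¬ (p : ℤ) % 3 = 0 := fun h0 ↦ by
      obtain ⟨r, hr⟩ := Int.dvd_of_emod_eq_zero h0
      rw [hr, mul_assoc] at hM
      omega
    omega
  obtain ⟨⟨u, v⟩, hπ⟩ := exists_normForm_seven_eq hp (by rintro rfl; norm_num at hp32) hsplit
  rw [← one_mul (p : ℤ)] at hπ
  obtain ⟨hv, hu⟩ := not_dvd_of_normForm_eq_mul hp hπ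
    (Nat.prime_iff_prime_int.1 hp).not_dvd_one
    (fun h ↦ by
      rw [show (4 * 2 - 1 ^ 2 : ℤ) = ((7 : ℕ) : ℤ) by norm_num, Int.natCast_dvd_natCast] at h
      rw [Nat.prime_dvd_prime_iff_eq hp (by norm_num)] at h
      omega)
  exact ⟨1, u, v, one_ne_zero, hπ, hv, hu, fun y _ ↦ weightSeven_pair hp32 hπ y⟩

theorem weightSeven_of_mod {a b : ℤ} (ha : a % 3 = 2) :
    weightSeven (a, b) = if b % 3 = 0 then 1 else if b % 3 = 2 then -1 else 0 := by
  have ha' : (a : ZMod 3) = 2 := by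
    rw [← sub_eq_zero, ← Int.cast_ofNat, ← Int.cast_sub, ZMod.intCast_zmod_eq_zero_iff_dvd]
    push_cast
    omega
  have hb0 : (b : ZMod 3) = 0 ↔ b % 3 = 0 := by
    rw [ZMod.intCast_zmod_eq_zero_iff_dvd]
    push_cast
    omega
  have hb2 : (b : ZMod 3) = 2 ↔ b % 3 = 2 := by
    rw [← sub_eq_zero, ← Int.cast_ofNat, ← Int.cast_sub, ZMod.intCast_zmod_eq_zero_iff_dvd]
    push_cast
    omega
  rw [weightSeven_eq]
  simp only [← hb0, ← hb2, ha']
  generalize (b : ZMod 3) = r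
  revert r
  decide

theorem weightSeven_of_dvd {a b : ℤ} (ha : a % 3 = 0) : weightSeven (a, b) = 0 := by
  have ha' : (a : ZMod 3) = 0 := by
    rw [ZMod.intCast_zmod_eq_zero_iff_dvd]
    push_cast
    omega
  simp [weightSeven, ha']

/-- The substitution `x = a - 3 * b`, `y = a + b` turns `x ^ 2 + 7 * y ^ 2 = 8 * N` into
`a ^ 2 + a * b + 2 * b ^ 2 = N`, provided that `x` and `y` agree modulo `4`. Hence `x = 6 * k - 1`
and `y = ± (6 * l - 1)`, where the sign, which depends on the parity of `k + l`, is the weight. -/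
theorem thetaCoeff_seven_eq (n : ℕ) :
    thetaCoeff 1 2 weightSeven (3 * n + 1) =
      2 * ∑ x ∈ pentagonalPairs 7 n, ((x.1 + x.2).negOnePow : ℤ) := by
  have hD : (0 : ℤ) < 4 * 2 - 1 ^ 2 := by norm_num
  rw [thetaCoeff_eq_two_mul hD (q := 2) Prod.fst (fun x ↦ by simp) weightSeven_neg
    ?_ (fun x _ _ h' ↦ weightSeven_of_dvd h')]
  · congr 1
    symm
    refine Finset.sum_of_injOn
      (fun x ↦ if 2 ∣ x.1 + x.2 then ((9 * x.2 + 3 * x.1 - 2) / 2, 3 * ((x.2 - x.1) / 2))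
        else ((3 * x.1 - 9 * x.2 + 1) / 2, (1 - 3 * x.1 - 3 * x.2) / 2)) ?_ ?_ ?_ ?_
    · rintro ⟨k, l⟩ - ⟨k', l'⟩ - h
      simp only at h
      split_ifs at h <;> simp only [Prod.mk.injEq] at h ⊢ <;> omega
    · rintro ⟨k, l⟩ hx
      rw [Finset.mem_coe, mem_pentagonalPairs (by norm_num)] at hx
      rw [Finset.mem_coe, Finset.mem_filter, mem_normReps hD]
      push_cast at hx
      simp only
      split_ifs with h
      · obtain ⟨t, ht⟩ := h
        obtain rfl : l = 2 * t - k := by linarith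
        rw [show (9 * (2 * t - k) + 3 * k - 2) / 2 = 9 * t - 3 * k - 1 by omega,
          show (2 * t - k - k) / 2 = t - k by omega]
        refine ⟨?_, by push_cast; omega, by omega⟩
        simp only [normForm]
        linarith
      · obtain ⟨t, ht⟩ : ∃ t, k + l = 2 * t + 1 := ⟨(k + l) / 2, by omega⟩
        obtain rfl : l = 2 * t + 1 - k := by linarith
        rw [show (3 * k - 9 * (2 * t + 1 - k) + 1) / 2 = 6 * k - 9 * t - 4 by omega,
          show (1 - 3 * k - 3 * (2 * t + 1 - k)) / 2 = - 3 * t - 1 by omega]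
        refine ⟨?_, by push_cast; omega, by omega⟩
        simp only [normForm]
        linarith
    · rintro ⟨a, b⟩ hx hx'
      rw [Finset.mem_filter, mem_normReps hD] at hx
      obtain ⟨hN, h2, h3⟩ := hx
      simp only [normForm] at hN h2 h3
      push_cast at h2
      rw [weightSeven_of_mod h3]
      -- invert `a - 3 * b = 6 * k - 1` and `a + b = ± (6 * l - 1)`
      obtain ⟨k, hk⟩ : ∃ k, a - 3 * b = 6 * k - 1 := ⟨(a - 3 * b + 1) / 6, by omega⟩
      obtain rfl : a = 6 * k - 1 + 3 * b := by linarith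
      split_ifs with hb hb'
      · refine (hx' ?_).elim
        obtain ⟨t, rfl⟩ := Int.dvd_of_emod_eq_zero hb
        refine ⟨(k, 2 * t + k), ?_, ?_⟩
        · rw [Finset.mem_coe, mem_pentagonalPairs (by norm_num)]
          push_cast
          linarith
        · refine (if_pos (by omega)).trans ?_
          ext <;> simp only <;> omega
      · refine (hx' ?_).elim
        obtain ⟨t, rfl⟩ : ∃ t, b = -3 * t - 1 := ⟨(-b - 1) / 3, by omega⟩
        refine ⟨(k, 2 * t + 1 - k), ?_, ?_⟩
        · rw [Finset.mem_coe, mem_pentagonalPairs (by norm_num)]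
          push_cast
          linarith
        · refine (if_neg (by omega)).trans ?_
          ext <;> simp only <;> omega
      · rfl
    · rintro ⟨k, l⟩ -
      rw [coe_negOnePow_eq_ite]
      simp only
      split_ifs
      · rw [weightSeven_of_mod (by omega), if_pos (by omega)]
      · rw [weightSeven_of_mod (by omega), if_neg (by omega), if_pos (by omega)]
  · exact sum_filter_dvd_add_eq_zero hD _ Nat.prime_two one_ne_zero (by norm_num)
      fun M _ y _ ↦ weightSeven_pair (q := 2) (by norm_num) (by norm_num [normForm]) y

/-! ### The arithmetic progressions -/

/-- Descent along the squares: a theta coefficient of index `p₁² ⋯ pₖ² * (p * L)` with `p ∤ L`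
vanishes if the Hecke relation holds at all primes involved. -/
theorem thetaCoeff_prod_sq_mul_eq_zero (hD : 0 < 4 * c - s ^ 2) {φ : ℤ × ℤ → ℤ} {m : ℕ}
    (hm : ∀ a x : ZMod m, a ^ 2 * x = 1 → x = 1) {P : ℕ → Prop} (hP : ∀ p, P p → p ≠ 0)
    (hφ : ∀ p : ℤ, IsUnit (p : ZMod m) → ∀ x, φ (p • x) = φ x)
    (hecke : ∀ p : ℕ, P p → ∀ M : ℤ, ((p * M : ℤ) : ZMod m) = 1 →
      ∑ x ∈ (normReps s c (p * M)).filter (fun x ↦ (p : ℤ) ∣ x.1 ∧ (p : ℤ) ∣ x.2), φ x = 0 →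
      thetaCoeff s c φ (p * M) = 0)
    {ι : Type*} (t : Finset ι) (p : ι → ℕ) (hp : ∀ i, P (p i)) {q : ℕ} (hq : P q) {L : ℤ}
    (hL : ¬ (q : ℤ) ∣ L) (h1 : (((∏ i ∈ t, (p i : ℤ) ^ 2) * (q * L) : ℤ) : ZMod m) = 1) :
    thetaCoeff s c φ ((∏ i ∈ t, (p i : ℤ) ^ 2) * (q * L)) = 0 := by
  classical
  induction t using Finset.induction_on with
  | empty =>
    rw [Finset.prod_empty, one_mul] at h1 ⊢
    exact hecke q hq L h1
      (sum_filter_dvd_eq_zero_of_not_dvd hD (by exact_mod_cast hP q hq) hL)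
  | insert i t hi ih =>
    rw [Finset.prod_insert hi, mul_assoc] at h1 ⊢
    rw [sq, mul_assoc] at h1 ⊢
    have h2 : (((∏ i ∈ t, (p i : ℤ) ^ 2) * (q * L) : ℤ) : ZMod m) = 1 := by
      apply hm (p i)
      rw [← h1]
      push_cast
      ring
    refine hecke _ (hp i) _ h1 ?_
    rw [sum_filter_dvd_eq_thetaCoeff hD (by exact_mod_cast hP _ (hp i)) (hφ _ ?_), ih h2]
    rw [Int.cast_mul] at h1
    exact IsUnit.of_mul_eq_one _ h1

/-- The congruence for `B 3 v`, from the two facts that are particular to `v`: the theta coefficient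
at `m * n + 1` is twice the pentagonal sum, and the Hecke relation holds at the primes allowed. -/
theorem B_modEq_zero_of_progressionArg (hD : 0 < 4 * c - s ^ 2) {φ : ℤ × ℤ → ℤ} {m : ℕ}
    (hm0 : m ≠ 0) (hm : ∀ a x : ZMod m, a ^ 2 * x = 1 → x = 1) {P : ℕ → Prop}
    (hP : ∀ p, P p → p.Prime)
    (hφ : ∀ p : ℤ, IsUnit (p : ZMod m) → ∀ x, φ (p • x) = φ x)
    (hecke : ∀ p : ℕ, P p → ∀ M : ℤ, ((p * M : ℤ) : ZMod m) = 1 →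
      ∑ x ∈ (normReps s c (p * M)).filter (fun x ↦ (p : ℤ) ∣ x.1 ∧ (p : ℤ) ∣ x.2), φ x = 0 →
      thetaCoeff s c φ (p * M) = 0)
    {v : ℕ} (hv : v ≠ 0) (htheta : ∀ n : ℕ, thetaCoeff s c φ (m * n + 1) =
      2 * ∑ x ∈ pentagonalPairs v n, ((x.1 + x.2).negOnePow : ℤ))
    {k n : ℕ} {p : Fin (k + 1) → ℕ} {j : ℤ} (hp : ∀ i, P (p i))
    (hj : ¬ (p (Fin.last k) : ℤ) ∣ j) {N : ℕ} (hN : (N : ℚ) = progressionArg m p n j) :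
    B 3 v N ≡ 0 [MOD 3] := by
  set q := p (Fin.last k) with hq
  have hindex : (m * N + 1 : ℤ) =
      (∏ i : Fin k, (p i.castSucc : ℤ) ^ 2) * (q * (m * q * n + m * j + q)) := by
    have hm0' : (m : ℚ) ≠ 0 := by exact_mod_cast hm0
    rw [progressionArg, Fin.prod_univ_castSucc, ← hq] at hN
    have : (m * N + 1 : ℚ) =
        (∏ i : Fin k, (p i.castSucc : ℚ) ^ 2) * (q * (m * q * n + m * j + q)) := by
      rw [hN]
      field_simp
      ring
    exact_mod_cast this
  have hpp : Prime (q : ℤ) := Nat.prime_iff_prime_int.1 (hP _ (hp _))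
  have hL : ¬ (q : ℤ) ∣ m * q * n + m * j + q := fun h ↦ by
    have hmj : (q : ℤ) ∣ m * j := by
      obtain ⟨t, ht⟩ := h
      exact ⟨t - m * n - 1, by linear_combination ht⟩
    refine hpp.not_dvd_one ?_
    obtain ⟨r, hr⟩ := (hpp.dvd_or_dvd hmj).resolve_right hj
    refine ⟨(∏ i : Fin k, (p i.castSucc : ℤ) ^ 2) * (m * q * n + m * j + q) - r * N, ?_⟩
    linear_combination hindex - N * hr
  have h0 := thetaCoeff_prod_sq_mul_eq_zero hD hm (fun p hp ↦ (hP p hp).ne_zero) hφ hecke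
    Finset.univ (fun i : Fin k ↦ p i.castSucc) (fun i ↦ hp _) (hp (Fin.last k)) hL
    (by rw [← hq, ← hindex]; push_cast; simp)
  rw [← hq, ← hindex, htheta] at h0
  have h1 := cast_B_three v N hv
  rw [(mul_eq_zero.1 h0).resolve_left two_ne_zero, Int.cast_zero] at h1
  exact (ZMod.natCast_eq_natCast_iff _ _ _).1 (by simpa using h1)

theorem exists_eq_progressionArg {m : ℕ} (hm0 : m ≠ 0) {k n : ℕ} {p : Fin (k + 1) → ℕ} {j : ℤ}
    (hp : ∀ i, ((p i : ℤ) : ZMod m) ^ 2 = 1) : ∃ z : ℤ, (z : ℚ) = progressionArg m p n j := by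
  set q := p (Fin.last k) with hq
  obtain ⟨t, ht⟩ : (m : ℤ) ∣ (∏ i : Fin k, (p i.castSucc : ℤ) ^ 2) * q ^ 2 - 1 := by
    rw [← intCast_eq_one_iff, Int.cast_mul, Int.cast_prod, Int.cast_pow, hq, hp, mul_one]
    exact Finset.prod_eq_one fun i _ ↦ by rw [Int.cast_pow, hp]
  refine ⟨(∏ i : Fin k, (p i.castSucc : ℤ) ^ 2) * q ^ 2 * n +
    (∏ i : Fin k, (p i.castSucc : ℤ) ^ 2) * q * j + t, ?_⟩
  have hm0' : (m : ℚ) ≠ 0 := by exact_mod_cast hm0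
  have ht' : (∏ i : Fin k, (p i.castSucc : ℚ) ^ 2) * q ^ 2 - 1 = m * t := by exact_mod_cast ht
  rw [progressionArg, Fin.prod_univ_castSucc, ← hq]
  push_cast
  field_simp
  linear_combination -ht'

theorem theorem1p2 (k n : ℕ) (p : Fin (k + 1) → ℕ) (j : ℤ)
    (hp : ∀ i, (p i).Prime) (hj : ¬ (p (Fin.last k) : ℤ) ∣ j) :
    ((∀ i, ¬ p i ≡ 1 [MOD 3]) →
      ((∀ i, p i ≠ 3) → ∃ z : ℤ, (z : ℚ) = progressionArg 3 p n j) ∧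
      ∀ N : ℕ, (N : ℚ) = progressionArg 3 p n j → B 3 7 N ≡ 0 [MOD 3]) ∧
    ((∀ i, p i ≡ 3 [MOD 4]) →
      (∃ z : ℤ, (z : ℚ) = progressionArg 4 p n j) ∧
      ∀ N : ℕ, (N : ℚ) = progressionArg 4 p n j → B 3 5 N ≡ 0 [MOD 3]) ∧
    ((∀ i, ¬ p i ≡ 1 [MOD 8]) →
      ((∀ i, p i ≠ 2) → ∃ z : ℤ, (z : ℚ) = progressionArg 8 p n j) ∧
      ∀ N : ℕ, (N : ℚ) = progressionArg 8 p n j → B 3 2 N ≡ 0 [MOD 3]) := by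
  have hodd : ∀ m : ℕ, 2 ∣ m → ∀ p : ℤ, IsUnit (p : ZMod m) → Odd p := fun m hm p hu ↦ by
    rw [← Int.not_even_iff_odd, even_iff_two_dvd]
    rintro ⟨r, rfl⟩
    obtain ⟨x, hx⟩ := hu.map (ZMod.castHom hm (ZMod 2))
    rw [map_intCast] at hx
    have : ((2 * r : ℤ) : ZMod 2) = 0 := by
      push_cast
      rw [show (2 : ZMod 2) = 0 from rfl, zero_mul]
    exact x.ne_zero (hx.trans this)
  refine ⟨fun h ↦ ⟨fun h3 ↦ ?_, fun N hN ↦ ?_⟩, fun h ↦ ⟨?_, fun N hN ↦ ?_⟩,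
    fun h ↦ ⟨fun h2 ↦ ?_, fun N hN ↦ ?_⟩⟩
  · refine exists_eq_progressionArg three_ne_zero fun i ↦ ?_
    have h0 : ((p i : ℕ) : ZMod 3) ≠ 0 := fun h0 ↦ by
      rw [ZMod.natCast_eq_zero_iff, Nat.prime_dvd_prime_iff_eq Nat.prime_three (hp i)] at h0
      exact h3 i h0.symm
    rw [Int.cast_natCast]
    revert h0
    generalize ((p i : ℕ) : ZMod 3) = r
    revert r
    decide
  · refine B_modEq_zero_of_progressionArg (s := 1) (c := 2) (φ := weightSeven) (m := 3)
      (P := fun p ↦ p.Prime ∧ ¬ p % 3 = 1) (by norm_num) (by norm_num) (by decide)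
      (fun p hp ↦ hp.1) (fun p hu x ↦ ?_) (fun p hp M ↦ thetaCoeff_seven_mul hp.1 hp.2)
      (by norm_num) thetaCoeff_seven_eq (fun i ↦ ⟨hp i, h i⟩) hj hN
    exact weightSeven_smul (hu.ne_zero) x
  · refine exists_eq_progressionArg four_ne_zero fun i ↦ ?_
    rw [Int.cast_natCast, (ZMod.natCast_eq_natCast_iff _ _ _).2 (h i)]
    rfl
  · exact B_modEq_zero_of_progressionArg (s := 0) (c := 5) (φ := weightFive) (m := 4)
      (P := fun p ↦ p.Prime ∧ p % 4 = 3) (by norm_num) (by norm_num) (by decide)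
      (fun p hp ↦ hp.1) (fun p hu x ↦ weightFive_smul (hodd 4 (by norm_num) p hu) x)
      (fun p hp M ↦ thetaCoeff_five_mul hp.1 hp.2)
      (by norm_num) thetaCoeff_five_eq (fun i ↦ ⟨hp i, h i⟩) hj hN
  · refine exists_eq_progressionArg (by norm_num) fun i ↦ ?_
    obtain ⟨r, hr⟩ := (hp i).odd_of_ne_two (h2 i)
    rw [Int.cast_natCast, hr]
    push_cast
    generalize (r : ZMod 8) = r
    revert r
    decide
  · exact B_modEq_zero_of_progressionArg (s := 0) (c := 2) (φ := weightTwo) (m := 8)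
      (P := fun p ↦ p.Prime ∧ ¬ p % 8 = 1) (by norm_num) (by norm_num) (by decide)
      (fun p hp ↦ hp.1) (fun p hu x ↦ weightTwo_smul (hodd 8 (by norm_num) p hu) x)
      (fun p hp M ↦ thetaCoeff_two_mul hp.1 hp.2)
      (by norm_num) thetaCoeff_two_eq (fun i ↦ ⟨hp i, h i⟩) hj hN
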